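/- Let $R$ be an associative ring with unit. For $0\le m\le\infty$, let $\mathcal{FP}_m$ denote the class of finitely $m$-presented right $R$-modules, i.e. those right $R$-modules $N$ for which there is an exact sequence $F_m\to\cdots\to F_1\to F_0\to N\to 0$ (for $m=\infty$: an infinite exact sequence $\cdots\to F_1\to F_0\to N\to 0$) with every $F_i$ finitely generated and free. For an integer $m \geq 0$, call $R$ (right) $m$-coherent if $\mathcal{FP}_m\subseteq\mathcal{FP}_{m+1}$. For $0\le m\le\infty$, a left $R$-module $M$ is $\mathrm{FP}_m$-flat if $\mathrm{Tor}_1^R(F,M)=0$ for all $F\in\mathcal{FP}_m$; the class of these modules is denoted $\mathcal{FP}_m\text{-Flat}$. For a class $\mathcal C$ of left $R$-modules let $\mathcal C^\perp$ (resp. ${}^\perp\mathcal C$) be the class of left $R$-modules $X$ with $\mathrm{Ext}^1_R(C,X)=0$ (resp. $\mathrm{Ext}^1_R(X,C)=0$) for all $C\in\mathcal C$. A pair $(\mathcal A,\mathcal B)$ of classes of left $R$-modules is a cotorsion pair if $\mathcal A^\perp=\mathcal B$ and $\mathcal A={}^\perp\mathcal B$; it is hereditary if moreover $\mathrm{Ext}^i_R(A,B)=0$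 for all $i>0$, $A\in\mathcal A$, $B\in\mathcal B$. A class is resolving if it contains all projective modules and is closed under extensions and under kernels of epimorphisms between its members. Theorem. For every integer $n>1$ the following conditions are equivalent. 1. $R$ is $n$-coherent. 2. $\mathcal{FP}_n\text{-Flat}=\mathcal{FP}_\infty\text{-Flat}$. 3. $\mathcal{FP}_n\text{-Flat}=\mathcal{FP}_{n+1}\text{-Flat}$. 4. $\mathcal{FP}_n\text{-Flat}$ is resolving. 5. $(\mathcal{FP}_n\text{-Flat},(\mathcal{FP}_n\text{-Flat})^\perp)$ is a hereditary cotorsion pair. 6. $\mathrm{Tor}_k^R(N,M)=0$ for every $k>1$, every $N\in\mathcal{FP}_n$ and every $M\in\mathcal{FP}_n\text{-Flat}$. -/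

import Mathlib

open CategoryTheory CategoryTheory.Limits MulOpposite
open scoped TensorProduct

universe u

noncomputable section

/-! ### Finitely `n`-presented modules and `n`-coherent rings -/

/-- For a ring `S` and `n : ℕ∞`, the class `FP n` of finitely `n`-presented (left) `S`-modules `M`:
there is an exact sequence `F n → ⋯ → F 1 → F 0 → M → 0` with every `F i` finitely generated and
free; for `n = ⊤` the sequence is an infinite resolution `⋯ → F 1 → F 0 → M → 0`.
For finite `n` the terms and maps of index beyond `n` are not constrained (they can be taken to be
zero). -/
def FinPresented (S : Type u) [Ring S] (n : ℕ∞) : ObjectProperty (ModuleCat.{u} S) := fun M =>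
  ∃ (F : ℕ → ModuleCat.{u} S) (d : ∀ i, F (i + 1) →ₗ[S] F i) (ε : F 0 →ₗ[S] M),
    (∀ i, Module.Free S (F i) ∧ Module.Finite S (F i)) ∧
    Function.Surjective ε ∧
    (1 ≤ n → Function.Exact (d 0) ε) ∧
    (∀ i : ℕ, ((i + 2 : ℕ) : ℕ∞) ≤ n → Function.Exact (d (i + 1)) (d i))

/-- Right `R`-modules are modules over `Rᵐᵒᵖ`. The ring `R` is (right) `n`-coherent if every
finitely `n`-presented right `R`-module is finitely `(n+1)`-presented. -/
def IsRightNCoherent (R : Type u) [Ring R] (n : ℕ) : Prop :=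
  FinPresented Rᵐᵒᵖ (n : ℕ∞) ≤ FinPresented Rᵐᵒᵖ ((n + 1 : ℕ) : ℕ∞)

/-! ### The tensor product over a noncommutative ring, and `Tor` -/

section Tensor

variable (R : Type u) [Ring R]

/-- The subgroup of `N ⊗[ℤ] M` generated by the elements `x r ⊗ y - x ⊗ r y`, for `N` a right and
`M` a left `R`-module. -/
def balancedRelations (N M : Type u) [AddCommGroup N] [Module Rᵐᵒᵖ N] [AddCommGroup M]
    [Module R M] : AddSubgroup (N ⊗[ℤ] M) :=
  AddSubgroup.closure
    {z | ∃ (x : N) (r : R) (y : M), z = (op r • x) ⊗ₜ[ℤ] y - x ⊗ₜ[ℤ] (r • y)}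

/-- The tensor product `N ⊗_R M` of a right `R`-module `N` and a left `R`-module `M`,
an abelian group. -/
abbrev BalancedTensor (N M : Type u) [AddCommGroup N] [Module Rᵐᵒᵖ N] [AddCommGroup M]
    [Module R M] : Type u :=
  (N ⊗[ℤ] M) ⧸ balancedRelations R N M

variable {R}

/-- The map `f ⊗ M : N ⊗_R M → N' ⊗_R M` induced by a map `f : N → N'` of right `R`-modules. -/
def BalancedTensor.map {N N' : Type u} [AddCommGroup N] [Module Rᵐᵒᵖ N]
    [AddCommGroup N'] [Module Rᵐᵒᵖ N'] (M : Type u) [AddCommGroup M] [Module R M]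
    (f : N →ₗ[Rᵐᵒᵖ] N') : BalancedTensor R N M →+ BalancedTensor R N' M :=
  QuotientAddGroup.map _ _ (LinearMap.rTensor M f.toAddMonoidHom.toIntLinearMap).toAddMonoidHom
    (by
      rw [balancedRelations, AddSubgroup.closure_le]
      rintro _ ⟨x, r, y, rfl⟩
      refine AddSubgroup.subset_closure ⟨f x, r, y, ?_⟩
      simp)

@[simp]
lemma BalancedTensor.map_mk_tmul {N N' : Type u} [AddCommGroup N] [Module Rᵐᵒᵖ N]
    [AddCommGroup N'] [Module Rᵐᵒᵖ N'] (M : Type u) [AddCommGroup M] [Module R M]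
    (f : N →ₗ[Rᵐᵒᵖ] N') (x : N) (y : M) :
    BalancedTensor.map M f (QuotientAddGroup.mk (x ⊗ₜ[ℤ] y)) =
      QuotientAddGroup.mk (f x ⊗ₜ[ℤ] y) := rfl

/-- Two additive maps out of `N ⊗_R M` which agree on pure tensors are equal. -/
lemma BalancedTensor.hom_ext {N M A : Type u} [AddCommGroup N] [Module Rᵐᵒᵖ N] [AddCommGroup M]
    [Module R M] [AddCommGroup A] {f g : BalancedTensor R N M →+ A}
    (h : ∀ (x : N) (y : M), f (QuotientAddGroup.mk (x ⊗ₜ[ℤ] y)) =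
      g (QuotientAddGroup.mk (x ⊗ₜ[ℤ] y))) : f = g := by
  apply AddMonoidHom.ext
  intro z
  induction z using QuotientAddGroup.induction_on with
  | H z =>
    induction z using TensorProduct.induction_on with
    | zero => simp
    | tmul x y => exact h x y
    | add a b ha hb => rw [QuotientAddGroup.mk_add, map_add, map_add, ha, hb]

variable (R)

/-- The functor `- ⊗_R M` from right `R`-modules to abelian groups, for a left `R`-module `M`. -/
def tensorRightFunctor (M : ModuleCat.{u} R) : ModuleCat.{u} Rᵐᵒᵖ ⥤ AddCommGrpCat.{u} where
  obj N := AddCommGrpCat.of (BalancedTensor R N M)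
  map f := AddCommGrpCat.ofHom (BalancedTensor.map M f.hom)
  map_id N := by
    ext1
    exact BalancedTensor.hom_ext fun x y => rfl
  map_comp f g := by
    ext1
    exact BalancedTensor.hom_ext fun x y => rfl

instance (M : ModuleCat.{u} R) : (tensorRightFunctor R M).Additive where
  map_add {X Y f g} := by
    ext1
    refine BalancedTensor.hom_ext fun x y => ?_
    change (QuotientAddGroup.mk ((f.hom x + g.hom x) ⊗ₜ[ℤ] y) : BalancedTensor R Y M) =
      QuotientAddGroup.mk (f.hom x ⊗ₜ[ℤ] y) + QuotientAddGroup.mk (g.hom x ⊗ₜ[ℤ] y)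
    rw [TensorProduct.add_tmul, QuotientAddGroup.mk_add]

/-- `Tor_k^R(N, M)`, for a right `R`-module `N` and a left `R`-module `M`: the value at `N` of the
`k`-th left derived functor of `- ⊗_R M`. -/
def torGroup (k : ℕ) (N : ModuleCat.{u} Rᵐᵒᵖ) (M : ModuleCat.{u} R) : AddCommGrpCat.{u} :=
  ((tensorRightFunctor R M).leftDerived k).obj N

/-- The class of `FP_n`-flat left `R`-modules, for `n : ℕ∞`: the modules `M` such that
`Tor_1^R(F, M) = 0` for all finitely `n`-presented right `R`-modules `F`. -/
def FPFlat (n : ℕ∞) : ObjectProperty (ModuleCat.{u} R) := fun M =>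
  ∀ F : ModuleCat.{u} Rᵐᵒᵖ, FinPresented Rᵐᵒᵖ n F → IsZero (torGroup R 1 F M)

end Tensor

/-! ### Resolving classes and cotorsion pairs of left `R`-modules -/

section Cotorsion

variable {R : Type u} [Ring R]

/-- The right orthogonal complement `C^⊥` of a class of modules, with respect to `Ext^1`. -/
def rightOrth (C : ObjectProperty (ModuleCat.{u} R)) : ObjectProperty (ModuleCat.{u} R) :=
  fun X => ∀ A : ModuleCat.{u} R, C A → Subsingleton (Abelian.Ext A X 1)

/-- The left orthogonal complement `^⊥C` of a class of modules, with respect to `Ext^1`. -/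
def leftOrth (C : ObjectProperty (ModuleCat.{u} R)) : ObjectProperty (ModuleCat.{u} R) :=
  fun X => ∀ B : ModuleCat.{u} R, C B → Subsingleton (Abelian.Ext X B 1)

/-- `(A, B)` is a cotorsion pair. -/
def IsCotorsionPair (A B : ObjectProperty (ModuleCat.{u} R)) : Prop :=
  rightOrth A = B ∧ A = leftOrth B

/-- `(A, B)` is a hereditary cotorsion pair: a cotorsion pair with `Ext^i(X, Y) = 0` for all
`i > 0`, `X` in `A` and `Y` in `B`. -/
def IsHereditaryCotorsionPair (A B : ObjectProperty (ModuleCat.{u} R)) : Prop :=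
  IsCotorsionPair A B ∧
    ∀ i : ℕ, 0 < i → ∀ X Y : ModuleCat.{u} R, A X → B Y → Subsingleton (Abelian.Ext X Y i)

/-- A class `A` of modules is resolving: it contains the projective modules and is closed under
extensions and under kernels of epimorphisms (between modules in `A`). -/
def IsResolving (A : ObjectProperty (ModuleCat.{u} R)) : Prop :=
  (∀ P : ModuleCat.{u} R, Module.Projective R P → A P) ∧
  (∀ S : ShortComplex (ModuleCat.{u} R), S.ShortExact → A S.X₁ → A S.X₃ → A S.X₂) ∧
  (∀ S : ShortComplex (ModuleCat.{u} R), S.ShortExact → A S.X₂ → A S.X₃ → A S.X₁)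

end Cotorsion

end

/-! ### Finitely presented modules and syzygies -/

section FinPresented

variable {S : Type u} [Ring S]

/-! Write `N⁺ = Hom_ℤ(N, ℚ/ℤ)`. Since `ℚ/ℤ` is an injective cogenerator and `(N ⊗ M)⁺ = Hom(M, N⁺)`,
for `i > 0` the group `Tor_i(N, M)` vanishes iff `Ext^i(M, N⁺)` does (`isZero_torGroup_succ_iff`).
So the `FP_n`-flat modules are the left orthogonal of the `N⁺` with `N` in `FP_n`, and they always
form the left half of a cotorsion pair. Under coherence syzygies can be chosen inside `FP_n`, whence
`FP_n = FP_∞`; the passage from condition 3 to condition 6 is dimension shifting.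

The way back from 6 to 1 tests against powers `R^I`, which are `FP_n`-flat when `n ≥ 2`
(`fpFlat_pi`). Then `Tor_n(N, R^I) = 0` shifts down to `Tor_1(L, R^I) = 0` for an `(n-1)`-st syzygy
`L` in `FP_1`. If `K ⊆ F` is a finitely generated syzygy of `L`, then `K ⊗ R^I` embeds in `F ⊗ R^I =
F^I`, so `K ⊗ R^I → K^I` is injective for all `I`. This forces `K` to be finitely presented
(`finite_ker_of_toPi_injective`), and `N` gains one more step of its resolution. -/

lemma FinPresented.mono {m n : ℕ∞} (h : m ≤ n) : FinPresented S n ≤ FinPresented S m := by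
  rintro M ⟨F, d, ε, hF, hε, h0, h1⟩
  exact ⟨F, d, ε, hF, hε, fun hm => h0 (hm.trans h), fun i hi => h1 i (hi.trans h)⟩

lemma finPresented_zero_iff (M : ModuleCat.{u} S) :
    FinPresented S ((0 : ℕ) : ℕ∞) M ↔ Module.Finite S M := by
  constructor
  · rintro ⟨F, d, ε, hF, hε, -⟩
    have := (hF 0).2
    exact Module.Finite.of_surjective ε hε
  · intro h
    obtain ⟨k, f, hf⟩ := Module.Finite.exists_fin' S M
    refine ⟨fun _ => ModuleCat.of S (Fin k → S), fun _ => 0, f,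
      fun _ => ⟨inferInstanceAs (Module.Free S (Fin k → S)),
        inferInstanceAs (Module.Finite S (Fin k → S))⟩, hf, fun h => ?_, fun i h => ?_⟩
    · simp at h
    · exact absurd (Nat.cast_le.mp h) (by omega)


lemma FinPresented.of_surjective_of_ker {k : ℕ} {N F : ModuleCat.{u} S} (ε : F →ₗ[S] N)
    (hF : Module.Free S F) (hF' : Module.Finite S F) (hε : Function.Surjective ε)
    (h : FinPresented S (k : ℕ∞) (ModuleCat.of S (LinearMap.ker ε))) :
    FinPresented S ((k + 1 : ℕ) : ℕ∞) N := by
  obtain ⟨G, d, η, hG, hη, h0, h1⟩ := h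
  let G' : ℕ → ModuleCat.{u} S := fun
    | 0 => F
    | i + 1 => G i
  let d' : ∀ i : ℕ, (G' (i + 1) : Type u) →ₗ[S] (G' i : Type u) := fun
    | 0 => (LinearMap.ker ε).subtype.comp η
    | i + 1 => d i
  refine ⟨G', d', ε, ?_, hε, fun _ => ?_, ?_⟩
  · rintro (_ | i)
    exacts [⟨hF, hF'⟩, hG i]
  · intro x
    constructor
    · intro hx
      obtain ⟨y, hy⟩ := hη ⟨x, hx⟩
      exact ⟨y, congrArg Subtype.val hy⟩
    · rintro ⟨y, rfl⟩
      exact (η y).2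
  · rintro (_ | i) hi
    · intro x
      have hk : (1 : ℕ∞) ≤ k := by
        have := Nat.cast_le.mp hi
        exact_mod_cast (show 1 ≤ k by omega)
      rw [← h0 hk x]
      exact Iff.symm Subtype.ext_iff
    · have := Nat.cast_le.mp hi
      exact h1 i (by exact_mod_cast (show i + 2 ≤ k by omega))

/-- The cover is the one in the given resolution, so syzygies of different covers never have to be
compared by Schanuel's lemma. -/
lemma FinPresented.exists_ker {k : ℕ} {N : ModuleCat.{u} S}
    (h : FinPresented S ((k + 1 : ℕ) : ℕ∞) N) :
    ∃ (F : ModuleCat.{u} S) (ε : F →ₗ[S] N), Module.Free S F ∧ Module.Finite S F ∧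
      Function.Surjective ε ∧ FinPresented S (k : ℕ∞) (ModuleCat.of S (LinearMap.ker ε)) := by
  obtain ⟨F, d, ε, hF, hε, h0, h1⟩ := h
  have h0 := h0 (by exact_mod_cast Nat.le_add_left 1 k)
  have hd : ∀ x, d 0 x ∈ LinearMap.ker ε := fun x => (h0 _).mpr ⟨x, rfl⟩
  refine ⟨F 0, ε, (hF 0).1, (hF 0).2, hε, fun i => F (i + 1), fun i => d (i + 1),
    (d 0).codRestrict _ hd, fun i => hF (i + 1), ?_, fun hk => ?_, fun i hi => ?_⟩
  · rintro ⟨x, hx⟩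
    obtain ⟨y, hy⟩ := (h0 x).mp hx
    exact ⟨y, Subtype.ext hy⟩
  · have hk : 1 ≤ k := by exact_mod_cast hk
    have := h1 0 (Nat.cast_le.mpr (by omega))
    intro x
    rw [← this x]
    exact Subtype.ext_iff
  · have := Nat.cast_le.mp hi
    exact h1 (i + 1) (Nat.cast_le.mpr (by omega))

/-- A class of modules in which every member has a finitely generated free cover with kernel in
the class consists of modules with resolutions by finitely generated free modules. -/
lemma FinPresented.top_of_forall_ker (C : ObjectProperty (ModuleCat.{u} S))
    (hC : ∀ N, C N → ∃ (F : ModuleCat.{u} S) (ε : F →ₗ[S] N), Module.Free S F ∧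
      Module.Finite S F ∧ Function.Surjective ε ∧ C (ModuleCat.of S (LinearMap.ker ε))) :
    C ≤ FinPresented S ⊤ := by
  choose F ε hF hF' hε hK using hC
  intro N hN
  -- The iterated syzygies of `N`, each carrying its membership in `C` so that the choice can be
  -- repeated.
  let Z : ℕ → {N : ModuleCat.{u} S // C N} := fun i =>
    Nat.rec ⟨N, hN⟩ (fun _ Y => ⟨_, hK Y.1 Y.2⟩) i
  refine ⟨fun i => F (Z i).1 (Z i).2,
    fun i => (LinearMap.ker (ε (Z i).1 (Z i).2)).subtype.comp (ε (Z (i + 1)).1 (Z (i + 1)).2),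
    ε (Z 0).1 (Z 0).2, fun i => ⟨hF _ _, hF' _ _⟩, hε _ _, fun _ x => ?_, fun i _ x => ?_⟩
  · constructor
    · intro hx
      obtain ⟨y, hy⟩ := hε (Z 1).1 (Z 1).2 ⟨x, hx⟩
      exact ⟨y, congrArg Subtype.val hy⟩
    · rintro ⟨y, rfl⟩
      exact (ε (Z 1).1 (Z 1).2 y).2
  · constructor
    · intro hx
      have hx : ε (Z (i + 1)).1 (Z (i + 1)).2 x = 0 := Subtype.ext hx
      obtain ⟨y, hy⟩ := hε (Z (i + 2)).1 (Z (i + 2)).2 ⟨x, hx⟩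
      exact ⟨y, congrArg Subtype.val hy⟩
    · rintro ⟨y, rfl⟩
      exact congrArg Subtype.val (show ε (Z (i + 1)).1 (Z (i + 1)).2 _ = 0 from
        (ε (Z (i + 2)).1 (Z (i + 2)).2 y).2)

end FinPresented

lemma IsRightNCoherent.finPresented_le_top {R : Type u} [Ring R] {n : ℕ}
    (h : IsRightNCoherent R n) : FinPresented Rᵐᵒᵖ (n : ℕ∞) ≤ FinPresented Rᵐᵒᵖ ⊤ :=
  FinPresented.top_of_forall_ker _ fun N hN => (h N hN).exists_ker

/-! ### Ext and injective or projective middle terms -/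

section Ext

open Abelian

variable {R : Type u} [Ring R] {S : ShortComplex (ModuleCat.{u} R)}

lemma subsingleton_ext_X₁_succ (hS : S.ShortExact) {X : ModuleCat.{u} R} {k : ℕ}
    (h₂ : Subsingleton (Ext X S.X₂ (k + 1))) (h₃ : Subsingleton (Ext X S.X₃ k)) :
    Subsingleton (Ext X S.X₁ (k + 1)) := by
  refine subsingleton_of_forall_eq 0 fun x => ?_
  obtain ⟨y, rfl⟩ := Ext.covariant_sequence_exact₁ X hS x (Subsingleton.elim _ _) rfl
  rw [Subsingleton.elim y 0, Ext.zero_comp]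

lemma subsingleton_ext_X₃ (hS : S.ShortExact) {X : ModuleCat.{u} R} {k : ℕ}
    (h₂ : Subsingleton (Ext X S.X₂ k)) (h₁ : Subsingleton (Ext X S.X₁ (k + 1))) :
    Subsingleton (Ext X S.X₃ k) := by
  refine subsingleton_of_forall_eq 0 fun x => ?_
  obtain ⟨y, rfl⟩ := Ext.covariant_sequence_exact₃ X hS x rfl (Subsingleton.elim _ _)
  rw [Subsingleton.elim y 0, Ext.zero_comp]

lemma subsingleton_ext_of_X₂_of_X₃ (hS : S.ShortExact) {Y : ModuleCat.{u} R} {k : ℕ}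
    (h₂ : Subsingleton (Ext S.X₂ Y k)) (h₃ : Subsingleton (Ext S.X₃ Y (k + 1))) :
    Subsingleton (Ext S.X₁ Y k) := by
  refine subsingleton_of_forall_eq 0 fun x => ?_
  obtain ⟨y, rfl⟩ := Ext.contravariant_sequence_exact₁ hS Y x (add_comm 1 k)
    (Subsingleton.elim _ _)
  rw [Subsingleton.elim y 0, Ext.comp_zero]

lemma subsingleton_ext_of_X₁_of_X₃ (hS : S.ShortExact) {Y : ModuleCat.{u} R} {k : ℕ}
    (h₁ : Subsingleton (Ext S.X₁ Y k)) (h₃ : Subsingleton (Ext S.X₃ Y k)) :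
    Subsingleton (Ext S.X₂ Y k) := by
  refine subsingleton_of_forall_eq 0 fun x => ?_
  obtain ⟨y, rfl⟩ := Ext.contravariant_sequence_exact₂ hS Y x (Subsingleton.elim _ _)
  rw [Subsingleton.elim y 0, Ext.comp_zero]

lemma subsingleton_ext_of_X₁_of_X₂ (hS : S.ShortExact) {Y : ModuleCat.{u} R} {k : ℕ}
    (h₁ : Subsingleton (Ext S.X₁ Y k)) (h₂ : Subsingleton (Ext S.X₂ Y (k + 1))) :
    Subsingleton (Ext S.X₃ Y (k + 1)) := by
  refine subsingleton_of_forall_eq 0 fun x => ?_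
  obtain ⟨y, rfl⟩ := Ext.contravariant_sequence_exact₃ hS Y x (Subsingleton.elim _ _)
    (add_comm 1 k)
  rw [Subsingleton.elim y 0, Ext.comp_zero]

/-- Dimension shifting. It starts at `Ext¹` of the cokernel, because `Hom` into an injective need
not vanish; the lowest case is the next lemma. -/
lemma subsingleton_ext_succ_iff_of_injective (hS : S.ShortExact) [Injective S.X₂]
    (X : ModuleCat.{u} R) (k : ℕ) :
    Subsingleton (Ext X S.X₁ (k + 2)) ↔ Subsingleton (Ext X S.X₃ (k + 1)) :=
  ⟨subsingleton_ext_X₃ hS (Ext.subsingleton_of_injective ..),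
    subsingleton_ext_X₁_succ hS (Ext.subsingleton_of_injective ..)⟩

lemma subsingleton_ext_one_iff_of_injective (hS : S.ShortExact) [Injective S.X₂]
    (X : ModuleCat.{u} R) :
    Subsingleton (Ext X S.X₁ 1) ↔ ∀ φ : X ⟶ S.X₃, ∃ ψ : X ⟶ S.X₂, ψ ≫ S.g = φ := by
  constructor
  · intro h φ
    obtain ⟨y, hy⟩ := Ext.covariant_sequence_exact₃ X hS (Ext.mk₀ φ) rfl (Subsingleton.elim _ _)
    obtain ⟨ψ, rfl⟩ := Ext.homEquiv₀.symm.surjective y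
    exact ⟨ψ, Ext.homEquiv₀.symm.injective (by simpa using hy)⟩
  · intro h
    refine subsingleton_of_forall_eq 0 fun x => ?_
    -- The index `0` stands for the vanishing of `Ext¹`.
    have := Ext.subsingleton_of_injective X S.X₂ 0
    obtain ⟨y, rfl⟩ := Ext.covariant_sequence_exact₁ X hS x (Subsingleton.elim _ _) rfl
    obtain ⟨φ, rfl⟩ := Ext.homEquiv₀.symm.surjective y
    obtain ⟨ψ, rfl⟩ := h φ
    simp [← Ext.mk₀_comp_mk₀]

end Ext

/-! ### Character modules over a noncommutative ring -/

section Character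

/-- Characters detect exactness. -/
lemma CharacterModule.exact_iff {A B C : Type*} [AddCommGroup A] [AddCommGroup B]
    [AddCommGroup C] {f : A →+ B} {g : B →+ C} (hfg : ∀ a, g (f a) = 0) :
    Function.Exact f g ↔ ∀ χ : CharacterModule B, (∀ a, χ (f a) = 0) →
      ∃ ψ : CharacterModule C, ∀ b, ψ (g b) = χ b := by
  constructor
  · intro h χ hχ
    -- `χ` descends to `B ⧸ ker g`, which embeds in `C`; injectivity of `ℚ/ℤ` extends it.
    let i : (B ⧸ g.ker) →ₗ[ℤ] C := (QuotientAddGroup.kerLift g).toIntLinearMap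
    obtain ⟨ψ, hψ⟩ := dual_surjective_of_injective i (QuotientAddGroup.kerLift_injective g)
      (QuotientAddGroup.lift g.ker (χ : B →+ AddCircle (1 : ℚ)) (fun b hb => by
        obtain ⟨a, rfl⟩ := (h b).mp hb
        exact hχ a))
    exact ⟨ψ, fun b => DFunLike.congr_fun hψ (QuotientAddGroup.mk b)⟩
  · intro h b
    refine ⟨fun hb => ?_, fun ⟨a, ha⟩ => ha ▸ hfg a⟩
    by_contra hb'
    have : (QuotientAddGroup.mk b : B ⧸ f.range) ≠ 0 :=
      fun h => hb' ((QuotientAddGroup.eq_zero_iff b).mp h)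
    obtain ⟨c, hc⟩ := exists_character_apply_ne_zero_of_ne_zero this
    let χ : CharacterModule B := AddMonoidHom.comp c (QuotientAddGroup.mk' f.range)
    obtain ⟨ψ, hψ⟩ := h χ fun a => by
      have : (QuotientAddGroup.mk (f a) : B ⧸ f.range) = 0 :=
        (QuotientAddGroup.eq_zero_iff _).mpr ⟨a, rfl⟩
      exact (congrArg c this).trans (map_zero c)
    exact hc ((hψ b).symm.trans ((congrArg ψ hb).trans (map_zero ψ)))

variable {R : Type u} [Ring R]

/-- The left module structure on the group of characters of a right module. -/
instance CharacterModule.moduleOfRight (N : Type u) [AddCommGroup N] [Module Rᵐᵒᵖ N] :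
    Module R (CharacterModule N) where
  smul r χ := AddMonoidHom.comp χ (DistribSMul.toAddMonoidHom N (op r))
  one_smul χ := CharacterModule.ext _ fun x => congrArg χ (one_smul Rᵐᵒᵖ x)
  mul_smul r s χ := CharacterModule.ext _ fun x => congrArg χ (mul_smul (op s) (op r) x)
  smul_zero _ := rfl
  smul_add _ _ _ := rfl
  add_smul r s χ := CharacterModule.ext _ fun x =>
    (congrArg χ (add_smul (op r) (op s) x)).trans (map_add χ _ _)
  zero_smul χ := CharacterModule.ext _ fun x =>
    (congrArg χ (zero_smul Rᵐᵒᵖ x)).trans (map_zero χ)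

/-- The right module structure on the group of characters of a left module. -/
instance CharacterModule.moduleOfLeft (M : Type u) [AddCommGroup M] [Module R M] :
    Module Rᵐᵒᵖ (CharacterModule M) where
  smul r χ := AddMonoidHom.comp χ (DistribSMul.toAddMonoidHom M (unop r))
  one_smul χ := CharacterModule.ext _ fun x => congrArg χ (one_smul R x)
  mul_smul r s χ := CharacterModule.ext _ fun x => congrArg χ (mul_smul (unop s) (unop r) x)
  smul_zero _ := rfl
  smul_add _ _ _ := rfl
  add_smul r s χ := CharacterModule.ext _ fun x =>
    (congrArg χ (add_smul (unop r) (unop s) x)).trans (map_add χ _ _)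
  zero_smul χ := CharacterModule.ext _ fun x =>
    (congrArg χ (zero_smul R x)).trans (map_zero χ)

section

variable {N N' M : Type u} [AddCommGroup N] [Module Rᵐᵒᵖ N] [AddCommGroup N'] [Module Rᵐᵒᵖ N']
  [AddCommGroup M] [Module R M]

/-- Precomposition of characters with a map of right modules. -/
def CharacterModule.rightDual (f : N →ₗ[Rᵐᵒᵖ] N') :
    CharacterModule N' →ₗ[R] CharacterModule N where
  toFun χ := AddMonoidHom.comp χ f.toAddMonoidHom
  map_add' _ _ := rfl
  map_smul' r χ := CharacterModule.ext _ fun x => congrArg χ (f.map_smul (op r) x).symm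

/-- Exchange of the arguments, `Hom_R(M, N⁺) → Hom_{Rᵐᵒᵖ}(N, M⁺)`. -/
def CharacterModule.flipLeft (φ : M →ₗ[R] CharacterModule N) :
    N →ₗ[Rᵐᵒᵖ] CharacterModule M where
  toFun x := AddMonoidHom.mk' (fun y => φ y x) fun y y' => by rw [map_add]; rfl
  map_add' x x' := CharacterModule.ext _ fun y => map_add (φ y) x x'
  map_smul' r x := CharacterModule.ext _ fun y =>
    (DFunLike.congr_fun (φ.map_smul (unop r) y) x).symm

/-- Exchange of the arguments, `Hom_{Rᵐᵒᵖ}(N, M⁺) → Hom_R(M, N⁺)`. -/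
def CharacterModule.flipRight (φ : N →ₗ[Rᵐᵒᵖ] CharacterModule M) :
    M →ₗ[R] CharacterModule N where
  toFun y := AddMonoidHom.mk' (fun x => φ x y) fun x x' => by rw [map_add]; rfl
  map_add' y y' := CharacterModule.ext _ fun x => map_add (φ x) y y'
  map_smul' r y := CharacterModule.ext _ fun x =>
    (DFunLike.congr_fun (φ.map_smul (op r) x) y).symm

/-- The character of `N ⊗_R M` defined by a map `M → N⁺`. -/
noncomputable def BalancedTensor.toCharacter (φ : M →ₗ[R] CharacterModule N) :
    CharacterModule (BalancedTensor R N M) :=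
  QuotientAddGroup.lift (balancedRelations R N M)
    (TensorProduct.liftAddHom
      ((CharacterModule.flipLeft φ).toAddMonoidHom : N →+ M →+ AddCircle (1 : ℚ))
      fun k x y => (map_zsmul (φ y) k x).trans
        (DFunLike.congr_fun (map_zsmul φ k y) x).symm) (by
    rw [balancedRelations, AddSubgroup.closure_le]
    rintro _ ⟨x, r, y, rfl⟩
    refine (map_sub _ _ _).trans (sub_eq_zero.mpr ?_)
    exact (DFunLike.congr_fun (φ.map_smul r y) x).symm)

lemma BalancedTensor.mk_smul_tmul (x : N) (r : R) (y : M) :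
    (QuotientAddGroup.mk ((op r • x) ⊗ₜ[ℤ] y) : BalancedTensor R N M) =
      QuotientAddGroup.mk (x ⊗ₜ[ℤ] (r • y)) := by
  rw [← sub_eq_zero, ← QuotientAddGroup.mk_sub, QuotientAddGroup.eq_zero_iff]
  exact AddSubgroup.subset_closure ⟨x, r, y, rfl⟩

/-- The map `M → N⁺` defined by a character of `N ⊗_R M`. -/
noncomputable def BalancedTensor.ofCharacter (χ : CharacterModule (BalancedTensor R N M)) :
    M →ₗ[R] CharacterModule N where
  toFun y := AddMonoidHom.mk' (fun x => χ (QuotientAddGroup.mk (x ⊗ₜ[ℤ] y))) fun x x' => by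
    rw [TensorProduct.add_tmul, QuotientAddGroup.mk_add, map_add]
  map_add' y y' := CharacterModule.ext _ fun x =>
    show χ _ = χ _ + χ _ by rw [TensorProduct.tmul_add, QuotientAddGroup.mk_add, map_add]
  map_smul' r y := CharacterModule.ext _ fun x => congrArg χ (mk_smul_tmul x r y).symm

@[elab_as_elim]
lemma BalancedTensor.induction {p : BalancedTensor R N M → Prop} (z : BalancedTensor R N M)
    (zero : p 0) (tmul : ∀ x y, p (QuotientAddGroup.mk (x ⊗ₜ[ℤ] y)))
    (add : ∀ a b, p a → p b → p (a + b)) : p z := by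
  induction z using QuotientAddGroup.induction_on with
  | H z =>
    induction z using TensorProduct.induction_on with
    | zero => exact zero
    | tmul x y => exact tmul x y
    | add a b ha hb => exact add _ _ ha hb

lemma BalancedTensor.character_ext {χ ψ : CharacterModule (BalancedTensor R N M)}
    (h : ∀ x y, χ (QuotientAddGroup.mk (x ⊗ₜ[ℤ] y)) = ψ (QuotientAddGroup.mk (x ⊗ₜ[ℤ] y))) :
    χ = ψ := by
  refine CharacterModule.ext _ fun z => ?_
  induction z using BalancedTensor.induction with
  | zero => rw [map_zero, map_zero]
  | tmul x y => exact h x y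
  | add a b ha hb => rw [map_add, map_add, ha, hb]

lemma BalancedTensor.map_surjective (M : Type u) [AddCommGroup M] [Module R M]
    {f : N →ₗ[Rᵐᵒᵖ] N'} (hf : Function.Surjective f) :
    Function.Surjective (BalancedTensor.map M f) := by
  intro z
  induction z using BalancedTensor.induction with
  | zero => exact ⟨0, map_zero _⟩
  | tmul x y =>
    obtain ⟨x, rfl⟩ := hf x
    exact ⟨QuotientAddGroup.mk (x ⊗ₜ[ℤ] y), rfl⟩
  | add a b ha hb =>
    obtain ⟨a, rfl⟩ := ha
    obtain ⟨b, rfl⟩ := hb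
    exact ⟨a + b, map_add _ _ _⟩

/-- A map is injective iff its character dual is surjective, and by adjunction the dual of `f ⊗ M`
is `Hom(M, N'⁺) → Hom(M, N⁺)`. -/
lemma BalancedTensor.map_injective_iff (M : Type u) [AddCommGroup M] [Module R M]
    (f : N →ₗ[Rᵐᵒᵖ] N') :
    Function.Injective (BalancedTensor.map M f) ↔ ∀ φ : M →ₗ[R] CharacterModule N,
      ∃ ψ : M →ₗ[R] CharacterModule N', (CharacterModule.rightDual f).comp ψ = φ := by
  have := CharacterModule.dual_surjective_iff_injective
    (f := (BalancedTensor.map M f).toIntLinearMap)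
  refine this.symm.trans ⟨fun h φ => ?_, fun h χ => ?_⟩
  · obtain ⟨χ, hχ⟩ := h (toCharacter φ)
    exact ⟨ofCharacter χ, LinearMap.ext fun y => CharacterModule.ext _ fun x =>
      DFunLike.congr_fun hχ (QuotientAddGroup.mk (x ⊗ₜ[ℤ] y))⟩
  · obtain ⟨ψ, hψ⟩ := h (ofCharacter χ)
    exact ⟨toCharacter ψ, character_ext fun x y =>
      DFunLike.congr_fun (DFunLike.congr_fun hψ y) x⟩

lemma BalancedTensor.map_exact_iff (M : Type u) [AddCommGroup M] [Module R M]
    {N'' : Type u} [AddCommGroup N''] [Module Rᵐᵒᵖ N'']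
    {f : N →ₗ[Rᵐᵒᵖ] N'} {g : N' →ₗ[Rᵐᵒᵖ] N''} (hfg : ∀ x, g (f x) = 0) :
    Function.Exact (BalancedTensor.map M f) (BalancedTensor.map M g) ↔
      ∀ φ : M →ₗ[R] CharacterModule N', (∀ y x, φ y (f x) = 0) →
        ∃ ψ : M →ₗ[R] CharacterModule N'', (CharacterModule.rightDual g).comp ψ = φ := by
  have h0 : ∀ z, BalancedTensor.map M g (BalancedTensor.map M f z) = 0 := by
    intro z
    induction z using BalancedTensor.induction with
    | zero => simp
    | tmul x y => simp [hfg]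
    | add a b ha hb => simp [ha, hb]
  rw [CharacterModule.exact_iff h0]
  refine ⟨fun h φ hφ => ?_, fun h χ hχ => ?_⟩
  · obtain ⟨χ, hχ⟩ := h (toCharacter φ) fun z => by
      induction z using BalancedTensor.induction with
      | zero => simp
      | tmul x y => exact hφ y x
      | add a b ha hb => rw [map_add, map_add, ha, hb, add_zero]
    exact ⟨ofCharacter χ, LinearMap.ext fun y => CharacterModule.ext _ fun x =>
      hχ (QuotientAddGroup.mk (x ⊗ₜ[ℤ] y))⟩
  · obtain ⟨ψ, hψ⟩ := h (ofCharacter χ) fun y x => hχ (QuotientAddGroup.mk (x ⊗ₜ[ℤ] y))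
    refine ⟨toCharacter ψ, fun z => ?_⟩
    induction z using BalancedTensor.induction with
    | zero => simp
    | tmul x y => exact DFunLike.congr_fun (DFunLike.congr_fun hψ y) x
    | add a b ha hb => rw [map_add, map_add, map_add, ha, hb]

/-- A map into `N'⁺` vanishing on the range of `f : N → N'` factors through `N''⁺` when
`N → N' → N'' → 0` is exact. -/
lemma CharacterModule.exists_rightDual_comp_eq
    {N'' : Type u} [AddCommGroup N''] [Module Rᵐᵒᵖ N'']
    {f : N →ₗ[Rᵐᵒᵖ] N'} {g : N' →ₗ[Rᵐᵒᵖ] N''} (hfg : Function.Exact f g)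
    (hg : Function.Surjective g) (φ : M →ₗ[R] CharacterModule N')
    (hφ : ∀ y x, φ y (f x) = 0) :
    ∃ ψ : M →ₗ[R] CharacterModule N'', (CharacterModule.rightDual g).comp ψ = φ := by
  -- After exchanging arguments, the map `N' → M⁺` kills `ker g = range f`, so it descends to `N''`.
  have hker : LinearMap.ker g ≤ LinearMap.ker (flipLeft φ) := fun x hx => by
    obtain ⟨x, rfl⟩ := (hfg x).mp hx
    exact CharacterModule.ext _ fun y => hφ y x
  let ψ : N'' →ₗ[Rᵐᵒᵖ] CharacterModule M :=
    ((LinearMap.ker g).liftQ (flipLeft φ) hker).comp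
      (g.quotKerEquivOfSurjective hg).symm.toLinearMap
  refine ⟨flipRight ψ, LinearMap.ext fun y => CharacterModule.ext _ fun x => ?_⟩
  have : (g.quotKerEquivOfSurjective hg).symm (g x) = Submodule.Quotient.mk x :=
    (g.quotKerEquivOfSurjective hg).symm_apply_eq.mpr rfl
  have : ψ (g x) = flipLeft φ x := by
    simp only [ψ, LinearMap.comp_apply, LinearEquiv.coe_coe, this]
    rfl
  exact DFunLike.congr_fun this y

lemma BalancedTensor.map_exact (M : Type u) [AddCommGroup M] [Module R M]
    {N'' : Type u} [AddCommGroup N''] [Module Rᵐᵒᵖ N'']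
    {f : N →ₗ[Rᵐᵒᵖ] N'} {g : N' →ₗ[Rᵐᵒᵖ] N''} (hfg : Function.Exact f g)
    (hg : Function.Surjective g) :
    Function.Exact (BalancedTensor.map M f) (BalancedTensor.map M g) :=
  (map_exact_iff M hfg.apply_apply_eq_zero).mpr
    (CharacterModule.exists_rightDual_comp_eq hfg hg)

end

end Character

/-! ### `Tor` vanishing as `Ext` vanishing -/

section TorExt

open Abelian

variable {R : Type u} [Ring R]

/-- The character module of a right `R`-module, as an object of the category of left modules. -/
noncomputable def rightCharacter (N : ModuleCat.{u} Rᵐᵒᵖ) : ModuleCat.{u} R :=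
  ModuleCat.of R (CharacterModule N)

lemma CharacterModule.rightDual_injective {N N' : Type u} [AddCommGroup N] [Module Rᵐᵒᵖ N]
    [AddCommGroup N'] [Module Rᵐᵒᵖ N'] {f : N →ₗ[Rᵐᵒᵖ] N'} (hf : Function.Surjective f) :
    Function.Injective (rightDual (R := R) f) := fun χ ψ h =>
  CharacterModule.ext _ fun x => by
    obtain ⟨x, rfl⟩ := hf x
    exact DFunLike.congr_fun h x

lemma CharacterModule.rightDual_surjective {N N' : Type u} [AddCommGroup N] [Module Rᵐᵒᵖ N]
    [AddCommGroup N'] [Module Rᵐᵒᵖ N'] {f : N →ₗ[Rᵐᵒᵖ] N'} (hf : Function.Injective f) :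
    Function.Surjective (rightDual (R := R) f) := fun χ => by
  obtain ⟨ψ, hψ⟩ := dual_surjective_of_injective f.toAddMonoidHom.toIntLinearMap hf χ
  exact ⟨ψ, CharacterModule.ext _ fun x => DFunLike.congr_fun hψ x⟩

lemma CharacterModule.rightDual_exact {N N' N'' : Type u} [AddCommGroup N] [Module Rᵐᵒᵖ N]
    [AddCommGroup N'] [Module Rᵐᵒᵖ N'] [AddCommGroup N''] [Module Rᵐᵒᵖ N'']
    {f : N →ₗ[Rᵐᵒᵖ] N'} {g : N' →ₗ[Rᵐᵒᵖ] N''} (h : Function.Exact f g) :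
    Function.Exact (rightDual (R := R) g) (rightDual (R := R) f) := by
  have hfg := h.apply_apply_eq_zero
  intro χ
  constructor
  · intro hχ
    obtain ⟨ψ, hψ⟩ := (CharacterModule.exact_iff (f := f.toAddMonoidHom)
      (g := g.toAddMonoidHom) hfg).mp h χ fun a => DFunLike.congr_fun hχ a
    exact ⟨ψ, CharacterModule.ext _ hψ⟩
  · rintro ⟨ψ, rfl⟩
    exact CharacterModule.ext _ fun x => (congrArg ψ (hfg x)).trans (map_zero ψ)

/-- The short exact sequence `0 → N⁺ → Q⁺ → K⁺ → 0` for an epimorphism `Q → N` with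
kernel `K`. -/
noncomputable def rightCharacterShortComplex {N Q : ModuleCat.{u} Rᵐᵒᵖ} (ε : Q →ₗ[Rᵐᵒᵖ] N) :
    ShortComplex (ModuleCat.{u} R) where
  X₁ := rightCharacter N
  X₂ := rightCharacter Q
  X₃ := rightCharacter (ModuleCat.of Rᵐᵒᵖ (LinearMap.ker ε))
  f := ModuleCat.ofHom (CharacterModule.rightDual ε)
  g := ModuleCat.ofHom (CharacterModule.rightDual (LinearMap.ker ε).subtype)
  zero := ModuleCat.hom_ext (LinearMap.ext fun (χ : CharacterModule N) =>
    CharacterModule.ext _ fun x => (congrArg χ x.2).trans (map_zero χ))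

lemma rightCharacterShortComplex_shortExact {N Q : ModuleCat.{u} Rᵐᵒᵖ} {ε : Q →ₗ[Rᵐᵒᵖ] N}
    (hε : Function.Surjective ε) : (rightCharacterShortComplex ε).ShortExact :=
  ModuleCat.shortComplex_shortExact _
    (CharacterModule.rightDual_exact (LinearMap.exact_subtype_ker_map ε))
    (CharacterModule.rightDual_injective hε)
    (CharacterModule.rightDual_surjective (Submodule.injective_subtype _))

/-- Exchanging arguments turns the extension of `X → Q⁺` along `X ↪ Y` into the lifting of `Q → X⁺`
through the surjection `Y⁺ → X⁺`. -/
lemma injective_rightCharacter (Q : ModuleCat.{u} Rᵐᵒᵖ) [Module.Projective Rᵐᵒᵖ Q] :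
    Injective (rightCharacter Q) where
  factors {X Y} φ f _ := by
    have hf : Function.Injective f := (ModuleCat.mono_iff_injective f).mp inferInstance
    let f' : CharacterModule Y →ₗ[Rᵐᵒᵖ] CharacterModule X :=
      { toFun := fun χ => AddMonoidHom.comp χ f.hom.toAddMonoidHom
        map_add' := fun _ _ => rfl
        map_smul' := fun r χ => CharacterModule.ext _ fun x =>
          congrArg χ (f.hom.map_smul (unop r) x).symm }
    have hf' : Function.Surjective f' := fun χ => by
      obtain ⟨ψ, hψ⟩ := CharacterModule.dual_surjective_of_injective
        f.hom.toAddMonoidHom.toIntLinearMap hf χ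
      exact ⟨ψ, CharacterModule.ext _ fun x => DFunLike.congr_fun hψ x⟩
    obtain ⟨ψ, hψ⟩ := Module.projective_lifting_property f'
      (CharacterModule.flipLeft φ.hom) hf'
    refine ⟨ModuleCat.ofHom (CharacterModule.flipRight ψ), ?_⟩
    ext x
    exact CharacterModule.ext _ fun q => DFunLike.congr_fun (DFunLike.congr_fun hψ q) x

lemma subsingleton_ext_rightCharacter_succ_iff {N Q : ModuleCat.{u} Rᵐᵒᵖ}
    [Module.Projective Rᵐᵒᵖ Q] {ε : Q →ₗ[Rᵐᵒᵖ] N} (hε : Function.Surjective ε)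
    (M : ModuleCat.{u} R) (k : ℕ) :
    Subsingleton (Ext M (rightCharacter N) (k + 2)) ↔
      Subsingleton (Ext M (rightCharacter (ModuleCat.of Rᵐᵒᵖ (LinearMap.ker ε))) (k + 1)) :=
  have : Injective (rightCharacterShortComplex ε).X₂ := injective_rightCharacter Q
  subsingleton_ext_succ_iff_of_injective (rightCharacterShortComplex_shortExact hε) M k

/-- As `Q⁺` is injective, the vanishing says that every `M → (ker ε)⁺` lifts to `Q⁺`; adjunction
reads this as injectivity of `ker ε ⊗ M → Q ⊗ M`. -/
lemma subsingleton_ext_one_rightCharacter_iff {N Q : ModuleCat.{u} Rᵐᵒᵖ}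
    [Module.Projective Rᵐᵒᵖ Q] {ε : Q →ₗ[Rᵐᵒᵖ] N} (hε : Function.Surjective ε)
    (M : ModuleCat.{u} R) :
    Subsingleton (Ext M (rightCharacter N) 1) ↔
      Function.Injective (BalancedTensor.map M (LinearMap.ker ε).subtype) := by
  have : Injective (rightCharacterShortComplex ε).X₂ := injective_rightCharacter Q
  refine (subsingleton_ext_one_iff_of_injective
    (rightCharacterShortComplex_shortExact hε) M).trans ?_
  rw [BalancedTensor.map_injective_iff]
  constructor
  · intro h φ
    obtain ⟨ψ, hψ⟩ := h (ModuleCat.ofHom φ)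
    exact ⟨ψ.hom, congrArg ModuleCat.Hom.hom hψ⟩
  · intro h φ
    obtain ⟨ψ, hψ⟩ := h φ.hom
    exact ⟨ModuleCat.ofHom ψ, ModuleCat.hom_ext hψ⟩

/-- Induction replaces `N` by its first syzygy. In the base case `P 1 ⊗ M` maps onto `ker ε ⊗ M`
with kernel the image of `P 2 ⊗ M`, so exactness at `P 1 ⊗ M` is injectivity of `ker ε ⊗ M → P 0 ⊗
M`. -/
lemma subsingleton_ext_rightCharacter_iff_exact (M : ModuleCat.{u} R) (k : ℕ)
    (N : ModuleCat.{u} Rᵐᵒᵖ) (P : ℕ → ModuleCat.{u} Rᵐᵒᵖ)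
    (d : ∀ i, P (i + 1) →ₗ[Rᵐᵒᵖ] P i) (ε : P 0 →ₗ[Rᵐᵒᵖ] N)
    (hP : ∀ i, Module.Projective Rᵐᵒᵖ (P i)) (hε : Function.Surjective ε)
    (h0 : Function.Exact (d 0) ε) (hd : ∀ i, Function.Exact (d (i + 1)) (d i)) :
    Subsingleton (Ext M (rightCharacter N) (k + 1)) ↔
      Function.Exact (BalancedTensor.map M (d (k + 1))) (BalancedTensor.map M (d k)) := by
  have hd0 : ∀ x, d 0 x ∈ LinearMap.ker ε := fun x => (h0 _).mpr ⟨x, rfl⟩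
  let η := (d 0).codRestrict (LinearMap.ker ε) hd0
  have hη : Function.Surjective η := fun x => by
    obtain ⟨y, hy⟩ := (h0 x.1).mp x.2
    exact ⟨y, Subtype.ext hy⟩
  have hdη : Function.Exact (d 1) η := fun x => by
    rw [← hd 0 x]
    exact Subtype.ext_iff
  induction k generalizing N P with
  | zero =>
    rw [subsingleton_ext_one_rightCharacter_iff hε]
    have hex := BalancedTensor.map_exact M hdη hη
    have hs := BalancedTensor.map_surjective M hη
    have hcomp : ∀ z, BalancedTensor.map M (d 0) z =
        BalancedTensor.map M (LinearMap.ker ε).subtype (BalancedTensor.map M η z) := fun z => by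
      induction z using BalancedTensor.induction with
      | zero => simp only [map_zero]
      | tmul x y => rfl
      | add a b ha hb => simp only [map_add, ha, hb]
    constructor
    · intro h z
      rw [← hex z, hcomp, map_eq_zero_iff _ h]
    · intro h
      refine (injective_iff_map_eq_zero _).mpr fun w hw => ?_
      obtain ⟨z, rfl⟩ := hs w
      rw [← hcomp] at hw
      exact (hex z).mpr ((h z).mp hw)
  | succ k ih =>
    rw [subsingleton_ext_rightCharacter_succ_iff hε]
    refine ih (ModuleCat.of Rᵐᵒᵖ (LinearMap.ker ε)) (fun i => P (i + 1)) (fun i => d (i + 1)) η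
      (fun i => hP (i + 1)) hη hdη (fun i => hd (i + 1)) (fun x => (hdη _).mpr ⟨x, rfl⟩) ?_ ?_
    · intro x
      obtain ⟨y, hy⟩ := (hdη x.1).mp x.2
      exact ⟨y, Subtype.ext hy⟩
    · intro x
      rw [← hd 1 x]
      exact Subtype.ext_iff

lemma isZero_torGroup_succ_iff (k : ℕ) (N : ModuleCat.{u} Rᵐᵒᵖ) (M : ModuleCat.{u} R) :
    IsZero (torGroup R (k + 1) N M) ↔ Subsingleton (Ext M (rightCharacter N) (k + 1)) := by
  let P := projectiveResolution N
  rw [subsingleton_ext_rightCharacter_iff_exact M k N P.complex.X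
    (fun i => (P.complex.d (i + 1) i).hom) (P.π.f 0).hom
    (fun i => (IsProjective.iff_projective _).mpr (P.projective i))
    ((ModuleCat.epi_iff_surjective (P.π.f 0)).mp inferInstance)
    ((ShortComplex.ShortExact.moduleCat_exact_iff_function_exact
      (ShortComplex.mk _ _ P.complex_d_comp_π_f_zero)).mp
        (ShortComplex.exact_of_g_is_cokernel _ P.isColimitCokernelCofork))
    (fun i => (ShortComplex.ShortExact.moduleCat_exact_iff_function_exact _).mp (P.exact_succ i))]
  rw [torGroup, (P.isoLeftDerivedObj (tensorRightFunctor R M) (k + 1)).isZero_iff]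
  refine (HomologicalComplex.exactAt_iff_isZero_homology _ _).symm.trans ?_
  rw [HomologicalComplex.exactAt_iff' _ (k + 2) (k + 1) k (by simp) (by simp)]
  exact ShortComplex.ab_exact_iff_function_exact _

lemma fpFlat_iff_ext (n : ℕ∞) (M : ModuleCat.{u} R) :
    FPFlat R n M ↔ ∀ N : ModuleCat.{u} Rᵐᵒᵖ, FinPresented Rᵐᵒᵖ n N →
      Subsingleton (Ext M (rightCharacter N) 1) :=
  forall₂_congr fun N _ => isZero_torGroup_succ_iff 0 N M

end TorExt

/-! ### Tensor products with powers of the ring -/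

section Power

variable {R : Type u} [Ring R]

section

variable (N : Type u) [AddCommGroup N] [Module Rᵐᵒᵖ N] (I : Type u)

/-- The canonical map `N ⊗_R R^I → N^I`. -/
noncomputable def BalancedTensor.toPi : BalancedTensor R N (I → R) →+ (I → N) :=
  QuotientAddGroup.lift (balancedRelations R N (I → R))
    (TensorProduct.liftAddHom
      (AddMonoidHom.mk' (fun x => AddMonoidHom.mk' (fun (y : I → R) i => op (y i) • x)
        fun y y' => funext fun i => add_smul (op (y i)) (op (y' i)) x)
        fun x x' => AddMonoidHom.ext fun y => funext fun i => smul_add (op (y i)) x x')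
      fun k x y => funext fun i => by
        change op (y i) • k • x = op (k • y i) • x
        rw [op_smul, smul_assoc, smul_comm]) (by
    rw [balancedRelations, AddSubgroup.closure_le]
    rintro _ ⟨x, r, y, rfl⟩
    refine (map_sub _ _ _).trans (sub_eq_zero.mpr (funext fun i => ?_))
    exact (mul_smul (op (y i)) (op r) x).symm)

variable {N I}

@[simp]
lemma BalancedTensor.toPi_mk_tmul (x : N) (y : I → R) (i : I) :
    toPi N I (QuotientAddGroup.mk (x ⊗ₜ[ℤ] y)) i = op (y i) • x := rfl

lemma BalancedTensor.toPi_map {N' : Type u} [AddCommGroup N'] [Module Rᵐᵒᵖ N']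
    (f : N →ₗ[Rᵐᵒᵖ] N') (z : BalancedTensor R N (I → R)) (i : I) :
    toPi N' I (BalancedTensor.map (I → R) f z) i = f (toPi N I z i) := by
  induction z using BalancedTensor.induction with
  | zero => simp
  | tmul x y => simp
  | add a b ha hb => simp [ha, hb]

/-- A tensor is a finite sum, so all its coordinates lie in the span of finitely many elements,
however large `I` is. -/
lemma BalancedTensor.exists_fg_toPi_mem (z : BalancedTensor R N (I → R)) :
    ∃ p : Submodule Rᵐᵒᵖ N, p.FG ∧ ∀ i, toPi N I z i ∈ p := by
  induction z using BalancedTensor.induction with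
  | zero => exact ⟨⊥, Submodule.fg_bot, fun i => by simp⟩
  | tmul x y =>
    exact ⟨Submodule.span _ {x}, Submodule.fg_span_singleton x,
      fun i => Submodule.smul_mem _ _ (Submodule.mem_span_singleton_self x)⟩
  | add a b ha hb =>
    obtain ⟨p, hp, ha⟩ := ha
    obtain ⟨q, hq, hb⟩ := hb
    refine ⟨p ⊔ q, hp.sup hq, fun i => ?_⟩
    rw [map_add]
    exact add_mem (Submodule.mem_sup_left (ha i)) (Submodule.mem_sup_right (hb i))

lemma BalancedTensor.exists_eq_sum {M : Type u} [AddCommGroup M] [Module R M]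
    {ι : Type*} [Fintype ι] {v : ι → N} (hv : Submodule.span Rᵐᵒᵖ (Set.range v) = ⊤)
    (z : BalancedTensor R N M) :
    ∃ y : ι → M, z = ∑ j, (QuotientAddGroup.mk (v j ⊗ₜ[ℤ] y j) : BalancedTensor R N M) := by
  induction z using BalancedTensor.induction with
  | zero => exact ⟨0, by simp⟩
  | tmul x y =>
    obtain ⟨c, rfl⟩ := (Submodule.mem_span_range_iff_exists_fun Rᵐᵒᵖ).mp
      (hv ▸ Submodule.mem_top : x ∈ Submodule.span Rᵐᵒᵖ (Set.range v))
    refine ⟨fun j => unop (c j) • y, ?_⟩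
    rw [TensorProduct.sum_tmul, QuotientAddGroup.mk_sum]
    exact Finset.sum_congr rfl fun j _ => mk_smul_tmul (v j) (unop (c j)) y
  | add a b ha hb =>
    obtain ⟨y, rfl⟩ := ha
    obtain ⟨y', rfl⟩ := hb
    refine ⟨y + y', ?_⟩
    rw [← Finset.sum_add_distrib]
    refine Finset.sum_congr rfl fun j _ => ?_
    rw [Pi.add_apply, TensorProduct.tmul_add, QuotientAddGroup.mk_add]

lemma BalancedTensor.toPi_surjective [Module.Finite Rᵐᵒᵖ N] :
    Function.Surjective (toPi (R := R) N I) := by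
  intro t
  obtain ⟨k, v, hv⟩ := Module.Finite.exists_fin (R := Rᵐᵒᵖ) (M := N)
  have (i : I) := (Submodule.mem_span_range_iff_exists_fun Rᵐᵒᵖ).mp
    (hv ▸ Submodule.mem_top : t i ∈ Submodule.span Rᵐᵒᵖ (Set.range v))
  choose c hc using this
  -- For fixed `j`, the coefficients of `v j` in the various `t i` assemble into one element of
  -- `R^I`.
  refine ⟨∑ j, QuotientAddGroup.mk (v j ⊗ₜ[ℤ] fun i => unop (c i j)), funext fun i => ?_⟩
  rw [map_sum, Finset.sum_apply, ← hc i]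
  rfl

lemma BalancedTensor.toPi_injective_of_free [Module.Free Rᵐᵒᵖ N] [Module.Finite Rᵐᵒᵖ N] :
    Function.Injective (toPi (R := R) N I) := by
  refine (injective_iff_map_eq_zero _).mpr fun z hz => ?_
  let b := Module.Free.chooseBasis Rᵐᵒᵖ N
  obtain ⟨y, rfl⟩ := exists_eq_sum b.span_eq z
  have hy : ∀ j, y j = 0 := fun j => funext fun i => by
    have := congrFun hz i
    rw [map_sum, Finset.sum_apply] at this
    exact op_injective (Fintype.linearIndependent_iff.mp b.linearIndependent
      (fun j => op (y j i)) this j)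
  simp [hy]

/-- `N ⊗_R R^I → N^I` is injective for a finitely presented module `N`. -/
lemma BalancedTensor.toPi_injective {G : Type u} [AddCommGroup G] [Module Rᵐᵒᵖ G]
    [Module.Free Rᵐᵒᵖ G] [Module.Finite Rᵐᵒᵖ G] {ε : G →ₗ[Rᵐᵒᵖ] N}
    (hε : Function.Surjective ε) [Module.Finite Rᵐᵒᵖ (LinearMap.ker ε)] :
    Function.Injective (toPi (R := R) N I) := by
  refine (injective_iff_map_eq_zero _).mpr fun z hz => ?_
  obtain ⟨w, rfl⟩ := map_surjective _ hε z
  have hw : ∀ i, ε (toPi G I w i) = 0 := fun i => by rw [← toPi_map, hz]; rfl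
  -- The coordinates of `w` lie in the finitely generated `ker ε`, so `w` comes from `ker ε ⊗ R^I`
  -- and dies in `N ⊗ R^I`.
  obtain ⟨w', hw'⟩ := toPi_surjective (R := R) (N := LinearMap.ker ε)
    (fun i => ⟨toPi G I w i, hw i⟩)
  have : BalancedTensor.map (I → R) (LinearMap.ker ε).subtype w' = w := by
    refine toPi_injective_of_free (funext fun i => ?_)
    rw [toPi_map, hw']
    rfl
  rw [← this]
  exact (map_exact (I → R) ε.exact_subtype_ker_map hε).apply_apply_eq_zero w'

/-- Take `I = ker ε` itself. The tautological family in `G^I` lifts to `G ⊗ R^I`; its image in `N ⊗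
R^I` vanishes by injectivity, so the lift comes from `ker ε ⊗ R^I`. Its coordinates, which are all
the elements of `ker ε`, then lie in a finitely generated submodule. -/
lemma BalancedTensor.finite_ker_of_toPi_injective {G : Type u} [AddCommGroup G]
    [Module Rᵐᵒᵖ G] [Module.Finite Rᵐᵒᵖ G] {ε : G →ₗ[Rᵐᵒᵖ] N} (hε : Function.Surjective ε)
    (h : Function.Injective (toPi (R := R) N (LinearMap.ker ε))) :
    Module.Finite Rᵐᵒᵖ (LinearMap.ker ε) := by
  obtain ⟨w, hw⟩ := toPi_surjective (R := R) (N := G) (I := LinearMap.ker ε) fun i => i.1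
  have hw0 : BalancedTensor.map (LinearMap.ker ε → R) ε w = 0 := by
    refine h (funext fun i => ?_)
    rw [toPi_map, hw, map_zero]
    exact i.2
  obtain ⟨w', rfl⟩ := (map_exact _ ε.exact_subtype_ker_map hε w).mp hw0
  obtain ⟨p, hp, hmem⟩ := exists_fg_toPi_mem w'
  have htop : p = ⊤ := eq_top_iff.mpr fun i _ => by
    have := congrFun hw i
    rw [toPi_map] at this
    rw [← Subtype.ext this]
    exact hmem i
  exact ⟨htop ▸ hp⟩

end

open Abelian

/-- Powers of `R` are `FP_n`-flat for `n ≥ 2`. -/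
lemma fpFlat_pi {n : ℕ} (hn : 1 < n) (I : Type u) :
    FPFlat R (n : ℕ∞) (ModuleCat.of R (I → R)) := by
  rw [fpFlat_iff_ext]
  intro N hN
  -- Two steps are needed so that the first syzygy is finitely presented and `toPi` is injective on
  -- it.
  obtain ⟨k, rfl⟩ : ∃ k, n = k + 1 + 1 := ⟨n - 2, by omega⟩
  obtain ⟨F, ε, hF, hF', hε, hL⟩ := hN.exists_ker
  obtain ⟨G, η, hG, hG', hη, hK⟩ := hL.exists_ker
  have : Module.Finite Rᵐᵒᵖ (LinearMap.ker η) :=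
    (finPresented_zero_iff _).mp (FinPresented.mono (by simp) _ hK)
  have hinj := BalancedTensor.toPi_injective (I := I) hη
  refine (subsingleton_ext_one_rightCharacter_iff hε _).mpr
    ((injective_iff_map_eq_zero _).mpr fun z hz => ?_)
  refine (injective_iff_map_eq_zero _).mp hinj z (funext fun i => Subtype.ext ?_)
  have := BalancedTensor.toPi_map (LinearMap.ker ε).subtype z i
  rw [hz, map_zero] at this
  exact this.symm

/-- A finitely `k`-presented module, `k ≥ 1`, is finitely `(k+1)`-presented as soon as
`Tor_k` against all powers of `R` vanishes. -/
lemma finPresented_succ_of_ext_pi (k : ℕ) (N : ModuleCat.{u} Rᵐᵒᵖ)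
    (hN : FinPresented Rᵐᵒᵖ ((k + 1 : ℕ) : ℕ∞) N)
    (h : ∀ I : Type u,
      Subsingleton (Ext (ModuleCat.of R (I → R)) (rightCharacter N) (k + 1))) :
    FinPresented Rᵐᵒᵖ ((k + 2 : ℕ) : ℕ∞) N := by
  induction k generalizing N with
  | zero =>
    obtain ⟨F, ε, hF, hF', hε, hL⟩ := hN.exists_ker
    have := (finPresented_zero_iff _).mp hL
    have hinj (I : Type u) := (subsingleton_ext_one_rightCharacter_iff hε _).mp (h I)
    -- With `K = ker ε`, the composite `K ⊗ R^I → F ⊗ R^I → F^I` is injective and factors through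
    -- `K^I`.
    have hpi (I : Type u) :
        Function.Injective (BalancedTensor.toPi (R := R) (LinearMap.ker ε) I) := by
      refine (injective_iff_map_eq_zero _).mpr fun z hz => ?_
      refine (injective_iff_map_eq_zero _).mp (hinj I) z ?_
      refine BalancedTensor.toPi_injective_of_free (funext fun i => ?_)
      refine (BalancedTensor.toPi_map (LinearMap.ker ε).subtype z i).trans ?_
      rw [hz, map_zero]
      rfl
    obtain ⟨m, η, hη⟩ := Module.Finite.exists_fin' Rᵐᵒᵖ (LinearMap.ker ε)
    refine FinPresented.of_surjective_of_ker ε hF hF' hε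
      (FinPresented.of_surjective_of_ker (F := ModuleCat.of Rᵐᵒᵖ (Fin m → Rᵐᵒᵖ)) η
        (inferInstanceAs (Module.Free Rᵐᵒᵖ (Fin m → Rᵐᵒᵖ)))
        (inferInstanceAs (Module.Finite Rᵐᵒᵖ (Fin m → Rᵐᵒᵖ))) hη
        ((finPresented_zero_iff _).mpr
          (BalancedTensor.finite_ker_of_toPi_injective hη (hpi _))))
  | succ k ih =>
    obtain ⟨F, ε, hF, hF', hε, hL⟩ := hN.exists_ker
    exact FinPresented.of_surjective_of_ker ε hF hF' hε (ih _ hL fun I =>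
      (subsingleton_ext_rightCharacter_succ_iff hε _ k).mp (h I))

end Power

/-! ### The class of `FP_n`-flat modules -/

section Flat

open Abelian

variable {R : Type u} [Ring R]

lemma FPFlat.mono {m n : ℕ∞} (h : m ≤ n) : FPFlat R m ≤ FPFlat R n :=
  fun _ hM F hF => hM F (FinPresented.mono h F hF)

lemma FPFlat.rightOrth_rightCharacter {n : ℕ∞} {N : ModuleCat.{u} Rᵐᵒᵖ}
    (hN : FinPresented Rᵐᵒᵖ n N) : rightOrth (FPFlat R n) (rightCharacter N) :=
  fun M hM => (fpFlat_iff_ext n M).mp hM N hN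

/-- The class is the left orthogonal of the modules `N⁺`, and these lie in its right orthogonal. -/
lemma isCotorsionPair_fpFlat (n : ℕ∞) :
    IsCotorsionPair (FPFlat R n) (rightOrth (FPFlat R n)) :=
  ⟨rfl, le_antisymm (fun M hM _ hB => hB M hM) fun M hM =>
    (fpFlat_iff_ext n M).mpr fun _ hN => hM _ (FPFlat.rightOrth_rightCharacter hN)⟩

/-- If `FP_{n+1}`-flat modules are `FP_n`-flat, the class of `FP_n`-flat modules is
resolving. -/
lemma FPFlat.isResolving_of_eq {n : ℕ}
    (h : FPFlat R (n : ℕ∞) = FPFlat R ((n + 1 : ℕ) : ℕ∞)) : IsResolving (FPFlat R (n : ℕ∞)) := by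
  refine ⟨fun P hP => ?_, fun S hS h₁ h₃ => ?_, fun S hS h₂ h₃ => ?_⟩
  · have := (IsProjective.iff_projective (R := R) P).mp hP
    exact (fpFlat_iff_ext _ P).mpr fun N _ => Ext.subsingleton_of_projective P _ 0
  · rw [fpFlat_iff_ext] at h₁ h₃ ⊢
    exact fun N hN => subsingleton_ext_of_X₁_of_X₃ hS (h₁ N hN) (h₃ N hN)
  -- By `h` it suffices to test `N` in `FP_{n+1}`, whose syzygy `K` is in `FP_n`; then `Ext²(X₃,
  -- N⁺)` vanishes because `Ext¹(X₃, K⁺)` does.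
  · rw [h, fpFlat_iff_ext]
    intro N hN
    obtain ⟨F, ε, hF, -, hε, hK⟩ := hN.exists_ker
    exact subsingleton_ext_of_X₂_of_X₃ hS
      ((fpFlat_iff_ext _ _).mp h₂ N (FinPresented.mono (by simp) N hN))
      ((subsingleton_ext_rightCharacter_succ_iff hε _ 0).mpr ((fpFlat_iff_ext _ _).mp h₃ _ hK))

/-- A module in a resolving class has no higher extensions into the right orthogonal
complement of the class. -/
lemma IsResolving.subsingleton_ext {A : ObjectProperty (ModuleCat.{u} R)} (hA : IsResolving A)
    (i : ℕ) {X Y : ModuleCat.{u} R} (hX : A X) (hY : rightOrth A Y) :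
    Subsingleton (Ext X Y (i + 1)) := by
  induction i generalizing X with
  | zero => exact hY X hX
  | succ i ih =>
    obtain ⟨P⟩ := EnoughProjectives.presentation X
    have hS := LinearMap.shortExact_shortComplexKer
      ((ModuleCat.epi_iff_surjective P.f).mp inferInstance)
    -- Closure under kernels of epimorphisms keeps the syzygy of `X` in `A`, so the degree drops by
    -- one.
    exact subsingleton_ext_of_X₁_of_X₂ hS
      (ih (hA.2.2 _ hS (hA.1 _ ((IsProjective.iff_projective (R := R) P.p).mpr P.projective)) hX))
      (Ext.subsingleton_of_projective P.p _ _)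

lemma isHereditaryCotorsionPair_of_isResolving {n : ℕ∞} (h : IsResolving (FPFlat R n)) :
    IsHereditaryCotorsionPair (FPFlat R n) (rightOrth (FPFlat R n)) := by
  refine ⟨isCotorsionPair_fpFlat n, fun i hi X Y hX hY => ?_⟩
  obtain ⟨i, rfl⟩ := Nat.exists_eq_succ_of_ne_zero hi.ne'
  exact h.subsingleton_ext i hX hY

end Flat

theorem theorem5p6 (R : Type u) [Ring R] (n : ℕ) (hn : 1 < n) :
    List.TFAE [
      IsRightNCoherent R n,
      FPFlat R (n : ℕ∞) = FPFlat R ⊤,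
      FPFlat R (n : ℕ∞) = FPFlat R ((n + 1 : ℕ) : ℕ∞),
      IsResolving (FPFlat R (n : ℕ∞)),
      IsHereditaryCotorsionPair (FPFlat R (n : ℕ∞)) (rightOrth (FPFlat R (n : ℕ∞))),
      ∀ k : ℕ, 1 < k → ∀ (N : ModuleCat.{u} Rᵐᵒᵖ) (M : ModuleCat.{u} R),
        FinPresented Rᵐᵒᵖ (n : ℕ∞) N → FPFlat R (n : ℕ∞) M → IsZero (torGroup R k N M)] := by
  have hle : (n : ℕ∞) ≤ ((n + 1 : ℕ) : ℕ∞) := Nat.cast_le.mpr n.le_succ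
  tfae_have 1 → 2 := fun h =>
    le_antisymm (FPFlat.mono le_top) fun _ hM F hF => hM F (h.finPresented_le_top F hF)
  tfae_have 2 → 3 := fun h =>
    le_antisymm (FPFlat.mono hle) ((FPFlat.mono le_top).trans h.ge)
  tfae_have 3 → 4 := FPFlat.isResolving_of_eq
  tfae_have 4 → 5 := isHereditaryCotorsionPair_of_isResolving
  tfae_have 5 → 6 := fun h k hk N M hN hM => by
    obtain ⟨k, rfl⟩ := Nat.exists_eq_succ_of_ne_zero (by omega : k ≠ 0)
    exact (isZero_torGroup_succ_iff k N M).mpr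
      (h.2 _ k.succ_pos _ _ hM (FPFlat.rightOrth_rightCharacter hN))
  tfae_have 6 → 1 := fun h N hN => by
    obtain ⟨k, rfl⟩ := Nat.exists_eq_succ_of_ne_zero (by omega : n ≠ 0)
    -- Condition 6 is used only in degree `n = k + 1`; `1 < n` both admits this degree and makes
    -- `R^I` an `FP_n`-flat module.
    exact finPresented_succ_of_ext_pi k N hN fun I =>
      (isZero_torGroup_succ_iff k N _).mp (h _ hn N _ hN (fpFlat_pi hn I))
  tfae_finish
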